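/- **Theorem 2.1.** Let $d,q\in\mathbb N_0$ and $0\le k_0<k_1<\dots<k_q\le d$. *The model.* For integers $0\le m\le n$ let $$P_n^m(x)=\frac{(-1)^m}{2^n\,n!}(1-x^2)^{m/2}\frac{d^{\,n+m}}{dx^{\,n+m}}(x^2-1)^n,\qquad x\in[-1,1],$$ be the associated Legendre function, and let $$Y_n^m(\theta,\phi)=\sqrt{(2n+1)\frac{(n-|m|)!}{(n+|m|)!}}\;P_n^{|m|}(\cos\theta)\,\psi_m(\phi),\qquad n\ge 0,\ |m|\le n,$$ where $\psi_m(\phi)=\sqrt2\cos(m\phi)$ for $m>0$, $\psi_0(\phi)=1$, and $\psi_m(\phi)=\sqrt2\sin(|m|\phi)$ for $m<0$. Let $f_d(\theta,\phi)\in\mathbb R^{(d+1)^2}$ be the vector with the entries $Y_n^m(\theta,\phi)$, $0\le n\le d$, $-n\le m\le n$. The degree-$d$ spherical harmonic regression model is $E[Y\mid\theta,\phi]=c^Tf_d(\theta,\phi)$, $\operatorname{Var}[Y\mid\theta,\phi]=\sigma^2>0$, with parameter vector $c=(c_n^m)\in\mathbb R^{(d+1)^2}$. A design is a probability measure $\xi$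 on $[0,\pi]\times(-\pi,\pi]$, and its information matrix is $M(\xi)=\int f_df_d^T\,d\xi$. *The linear combinations.* Let $s=\sum_{i=0}^q(2k_i+1)$ and let $K=K_{k_0,\dots,k_q}\in\mathbb R^{(d+1)^2\times s}$ be the matrix for which $K^Tc$ is the vector of all coefficients $c_{k_i}^m$ with $0\le i\le q$, $-k_i\le m\le k_i$; that is, in block row $i$ of $K^T$ the block at level $k_i$ is $I_{2k_i+1}$ and all other blocks are zero. $K^Tc$ is estimable under $\xi$ if $\operatorname{range}(K)\subset\operatorname{range}(M(\xi))$. In that case $V(\xi)=K^TM^-(\xi)K$ is symmetric positive definite and does not depend on the choice of the generalized inverse $M^-(\xi)$ (a matrix with $M M^- M=M$), and one puts $$\Phi_p(\xi)=\bigl(\operatorname{tr}V(\xi)^{-p}\bigr)^{1/p}\quad(p\in(-\infty,1),\ p\ne0),\qquad \Phi_0(\xi)=\det V(\xi)^{-1},\qquad \Phi_{-\infty}(\xi)=\lambda_{\min}\bigl(V(\xi)^{-1}\bigr).$$ A design is $\Phi_p$-optimal for estimating $K^Tc$ if $K^Tc$ is estimable under it and it maximizes $\Phi_p$ among all designs under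 which $K^Tc$ is estimable. *Claim.* For every $p\in[-\infty,1)$ the uniform distribution on the sphere, $$\xi^*(d\theta,d\phi)=\frac1{4\pi}\sin\theta\,d\theta\,d\phi,$$ is $\Phi_p$-optimal for estimating $K^Tc$. Moreover, $M(\xi^*)=I_{(d+1)^2}$. -/

import Mathlib

open MeasureTheory Matrix

noncomputable section

namespace SphericalDesign

/-! ### Spherical harmonics -/

/-- The associated Legendre function `P_n^m` of degree `n` and order `m`, given by
`P_n^m(x) = (-1)^m / (2^n n!) * (1 - x^2)^(m/2) * d^(n+m)/dx^(n+m) (x^2 - 1)^n`.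
In particular `P_n^0` is the `n`-th Legendre polynomial, with `P_n^0(1) = 1`. -/
def assocLegendre (n m : ℕ) (x : ℝ) : ℝ :=
  (-1) ^ m / (2 ^ n * (n.factorial : ℝ)) * (√(1 - x ^ 2)) ^ m *
    (Polynomial.derivative^[n + m] ((Polynomial.X ^ 2 - 1 : Polynomial ℝ) ^ n)).eval x

/-- The azimuthal factor: `√2 cos (m φ)` for `m > 0`, `1` for `m = 0`, and
`√2 sin (|m| φ)` for `m < 0`. -/
def azimuthal (m : ℤ) (φ : ℝ) : ℝ :=
  if 0 < m then √2 * Real.cos (m * φ)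
  else if m = 0 then 1
  else √2 * Real.sin (m.natAbs * φ)

/-- The real spherical harmonic `Y_n^m` (for `|m| ≤ n`) at polar angle `θ` and azimuth `φ`,
`Y_n^m(θ, φ) = √((2 n + 1) (n - |m|)! / (n + |m|)!) * P_n^{|m|}(cos θ) * azimuthal m φ`. -/
def sphHarmonic (n : ℕ) (m : ℤ) (θ φ : ℝ) : ℝ :=
  √((2 * (n : ℝ) + 1) * ((n - m.natAbs).factorial : ℝ) / ((n + m.natAbs).factorial : ℝ)) *
    assocLegendre n m.natAbs (Real.cos θ) * azimuthal m φ

/-- The orders `m ∈ {-n, …, n}` at resolution level `n`. -/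
abbrev Order (n : ℕ) : Type := {m : ℤ // m ∈ Finset.Icc (-(n : ℤ)) (n : ℤ)}

/-- The index set `{(n, m) : 0 ≤ n ≤ d, -n ≤ m ≤ n}` of the `(d + 1)^2` coefficients. -/
abbrev CoeffIndex (d : ℕ) : Type := Σ n : Fin (d + 1), Order n

/-- The vector `f_d(θ, φ)` of regression functions of the model of degree `d`. -/
def regressionVec (d : ℕ) (z : ℝ × ℝ) : CoeffIndex d → ℝ :=
  fun a => sphHarmonic a.1 a.2 z.1 z.2

/-! ### Designs and information matrices -/

/-- The design region `[0, π] × (-π, π]`. -/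
def designRegion : Set (ℝ × ℝ) := Set.Icc 0 Real.pi ×ˢ Set.Ioc (-Real.pi) Real.pi

/-- An approximate design: a probability measure carried by the design region. -/
structure IsDesign (ξ : Measure (ℝ × ℝ)) : Prop where
  isProbabilityMeasure : IsProbabilityMeasure ξ
  compl_null : ξ designRegionᶜ = 0

/-- The information matrix `M(ξ) = ∫ f_d f_dᵀ dξ`. -/
def infoMatrix (d : ℕ) (ξ : Measure (ℝ × ℝ)) : Matrix (CoeffIndex d) (CoeffIndex d) ℝ :=
  Matrix.of fun a b => ∫ z, regressionVec d z a * regressionVec d z b ∂ξ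

/-- The uniform distribution on the sphere in spherical coordinates, i.e. the measure with
density `(1 / 4π) sin θ dθ dφ` on the design region. -/
def uniformDesign : Measure (ℝ × ℝ) :=
  (volume.restrict designRegion).withDensity
    fun z => ENNReal.ofReal (1 / (4 * Real.pi) * Real.sin z.1)

/-! ### Generalized inverses -/

section GeneralizedInverse

variable {m n : Type*} [Fintype m] [Fintype n] [DecidableEq m] [DecidableEq n]

/-- `G` is a generalized inverse of `A`. -/
def IsGenInverse (A : Matrix m n ℝ) (G : Matrix n m ℝ) : Prop := A * G * A = A

theorem exists_isGenInverse (A : Matrix m n ℝ) : ∃ G : Matrix n m ℝ, IsGenInverse A G := by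
  obtain ⟨s, hs⟩ := LinearMap.exists_rightInverse_of_surjective
    (Matrix.toLin' A).rangeRestrict (LinearMap.range_rangeRestrict _)
  obtain ⟨π, hπ⟩ := LinearMap.exists_leftInverse_of_injective
    (LinearMap.range (Matrix.toLin' A)).subtype (Submodule.ker_subtype _)
  refine ⟨LinearMap.toMatrix' (s ∘ₗ π), ?_⟩
  apply Matrix.toLin'.injective
  rw [Matrix.toLin'_mul, Matrix.toLin'_mul, Matrix.toLin'_toMatrix']
  refine LinearMap.ext fun x => ?_
  have h1 : π (Matrix.toLin' A x) = (Matrix.toLin' A).rangeRestrict x :=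
    LinearMap.congr_fun hπ ((Matrix.toLin' A).rangeRestrict x)
  have h2 := congrArg Subtype.val
    (LinearMap.congr_fun hs ((Matrix.toLin' A).rangeRestrict x))
  simp only [LinearMap.comp_apply] at h2 ⊢
  rw [h1]
  exact h2

/-- A generalized inverse `A⁻` of `A`; where it is used, its choice does not matter
(`transpose_mul_genInverse_mul`). -/
def genInverse (A : Matrix m n ℝ) : Matrix n m ℝ := Classical.choose (exists_isGenInverse A)

theorem isGenInverse_genInverse (A : Matrix m n ℝ) : IsGenInverse A (genInverse A) :=
  Classical.choose_spec (exists_isGenInverse A)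

/-- `range K ⊆ range M`: the linear combinations `Kᵀ c` are estimable under the information
matrix `M`. -/
def Estimable (K : Matrix m n ℝ) (M : Matrix m m ℝ) : Prop :=
  LinearMap.range K.mulVecLin ≤ LinearMap.range M.mulVecLin

/-- Under estimability, `Kᵀ M⁻ K` does not depend on the generalized inverse. -/
theorem transpose_mul_genInverse_mul (K : Matrix m n ℝ) (M G : Matrix m m ℝ)
    (hM : M.IsSymm) (hK : Estimable K M) (hG : IsGenInverse M G) :
    Kᵀ * genInverse M * K = Kᵀ * G * K := by
  have hL : ∃ L : Matrix m n ℝ, K = M * L := by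
    have h : ∀ j : n, ∃ v : m → ℝ, M *ᵥ v = K *ᵥ Pi.single j 1 := fun j =>
      hK ⟨Pi.single j 1, rfl⟩
    choose v hv using h
    refine ⟨Matrix.of fun i j => v j i, ?_⟩
    ext i j
    have := congrFun (hv j) i
    simp only [Matrix.mulVec_single_one] at this
    exact this.symm
  obtain ⟨L, rfl⟩ := hL
  have key : ∀ H : Matrix m m ℝ, IsGenInverse M H →
      (M * L)ᵀ * H * (M * L) = Lᵀ * M * L := fun H hH => by
    rw [Matrix.transpose_mul, hM.eq]
    calc Lᵀ * M * H * (M * L) = Lᵀ * (M * H * M) * L := by simp only [Matrix.mul_assoc]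
      _ = Lᵀ * M * L := by rw [hH]
  rw [key _ (isGenInverse_genInverse M), key _ hG]

end GeneralizedInverse

/-! ### Kiefer's criteria and optimality -/

/-- Kiefer's criterion as a function of `V = Kᵀ M⁻ K`, for `p ∈ [-∞, 1)`: the smallest eigenvalue
of `V⁻¹` for `p = -∞`, the determinant of `V⁻¹` for `p = 0`, and `(tr V^(-p))^(1/p)` for the
other real `p`, where the real power of the symmetric positive definite matrix `V` is taken in
the functional calculus, i.e. on its eigenvalues. -/
def kiefer {n : Type*} [Fintype n] [DecidableEq n] (p : WithBot ℝ) (V : Matrix n n ℝ) : ℝ :=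
  match p with
  | ⊥ => sInf (spectrum ℝ V⁻¹)
  | (p : ℝ) =>
    if p = 0 then V⁻¹.det
    else (Matrix.trace (cfc (fun x : ℝ => x ^ (-p)) V)) ^ (1 / p)

/-- The value `Φ_p(ξ)` of the criterion for estimating `Kᵀ c` with the design `ξ`. -/
def Phi {d : ℕ} {n : Type*} [Fintype n] [DecidableEq n] (p : WithBot ℝ)
    (K : Matrix (CoeffIndex d) n ℝ) (ξ : Measure (ℝ × ℝ)) : ℝ :=
  kiefer p (Kᵀ * genInverse (infoMatrix d ξ) * K)

/-- `ξ₀` is `Φ_p`-optimal for estimating `Kᵀ c`: it is a design under which `Kᵀ c` is estimable,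
and it maximizes `Φ_p` among all such designs. -/
structure IsPhiOptimal {d : ℕ} {n : Type*} [Fintype n] [DecidableEq n] (p : WithBot ℝ)
    (K : Matrix (CoeffIndex d) n ℝ) (ξ₀ : Measure (ℝ × ℝ)) : Prop where
  isDesign : IsDesign ξ₀
  estimable : Estimable K (infoMatrix d ξ₀)
  le : ∀ ξ : Measure (ℝ × ℝ), IsDesign ξ → Estimable K (infoMatrix d ξ) →
    Phi p K ξ ≤ Phi p K ξ₀

/-- The block matrix `K = K_{k_0,…,k_q}`: the block of `Kᵀ` in block row `i` and block column `j`
is the identity if `j = k_i` and zero otherwise, so that `Kᵀ c` consists of the coefficients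
of the levels `k_0, …, k_q`. -/
def selectionMatrix {d q : ℕ} (k : Fin (q + 1) → Fin (d + 1)) :
    Matrix (CoeffIndex d) (Σ i : Fin (q + 1), Order (k i)) ℝ :=
  Matrix.of fun a b => if a.1 = k b.1 ∧ (a.2 : ℤ) = (b.2 : ℤ) then 1 else 0

end SphericalDesign

end

/-!
Two facts make the uniform distribution on the sphere optimal for every criterion at once.

The information bound: if `Kᵀ K = 1` and `K = M L`, then `V = Kᵀ M⁻ K = Lᵀ M L` satisfies
`V⁻¹ ≤ Kᵀ M K`, hence `tr V⁻¹ ≤ tr (Kᵀ M K)` (`posDef_and_trace_inv_le`). Since complete levels of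
harmonics are selected, Unsöld's theorem `∑ₘ (Y_n^m)² = 2 n + 1` (`sum_sphHarmonic_sq`) makes the
right-hand side equal to the number `s` of selected coefficients, whatever the design. Under the
constraint `tr V⁻¹ ≤ s` on the inverse eigenvalues `μᵢ`, every criterion is largest at `V = 1`: for
`p ≠ 0` and `p = 0` by the tangent line at `1` of `μ ↦ μ ^ p` and of `exp`, for `p = -∞` because the
minimum is at most the mean (`kiefer_le_kiefer_one`). The uniform distribution attains `V = 1`,
its information matrix being the identity (`infoMatrix_uniformDesign`).

Both facts about harmonics come from Legendre's differential equation, differentiated `m` times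
(`legendreDeriv_ode`). It makes the derivative of `∑ₘ (n-|m|)!/(n+|m|)! (P_n^{|m|})²` telescope to
zero, which is Unsöld's theorem (`legendreSq_sum`). It also gives, by one integration by parts, a
recursion in `m` for the inner products of the `P_n^m` (`legendreInner_succ`). The recursion yields
orthogonality, because the inner product is symmetric, and shows that the `2 n + 1` terms of
Unsöld's sum have equal integrals over `[-1, 1]`; as their sum is `1`, each integral is
`2 / (2 n + 1)`, the required normalization.
-/

noncomputable section

namespace SphericalDesign

/-! ### Kiefer's criteria -/

section Kiefer

variable {n : Type*} [Fintype n] [DecidableEq n]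

theorem trace_cfc_eq_sum_eigenvalues {V : Matrix n n ℝ} (hV : V.IsHermitian) (f : ℝ → ℝ) :
    trace (cfc f V) = ∑ i, f (hV.eigenvalues i) := by
  rw [hV.cfc_eq, IsHermitian.cfc, Unitary.conjStarAlgAut_apply, trace_mul_comm, ← mul_assoc]
  simp [trace_diagonal]

theorem trace_inv_eq_sum_inv_eigenvalues {V : Matrix n n ℝ} (hV : V.PosDef) :
    trace V⁻¹ = ∑ i, (hV.1.eigenvalues i)⁻¹ := by
  rw [← trace_cfc_eq_sum_eigenvalues hV.1 (fun x => x⁻¹)]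
  congr 1
  obtain ⟨u, rfl⟩ := hV.isUnit
  have h := cfc_inv_id (R := ℝ) u (ha := hV.1)
  rw [h, coe_units_inv]

theorem sInf_spectrum_inv_le {V : Matrix n n ℝ} (hV : V.PosDef) (i : n) :
    sInf (spectrum ℝ V⁻¹) ≤ (hV.1.eigenvalues i)⁻¹ := by
  refine csInf_le (Matrix.finite_real_spectrum).bddBelow ?_
  have h := hV.1.eigenvalues_mem_spectrum_real i
  have h0 := hV.eigenvalues_pos i
  obtain ⟨u, hu⟩ := hV.isUnit
  generalize hV.1.eigenvalues i = r at h h0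
  subst hu
  rw [← coe_units_inv]
  exact (spectrum.inv_mem_iff (r := Units.mk0 r h0.ne') (a := u)).1 h

/-- The tangent line at `1` of the convex function `x ↦ x ^ p`, `p < 0`, lies below its graph. -/
theorem one_add_mul_sub_one_le_rpow {p x : ℝ} (hp : p < 0) (hx : 0 < x) :
    1 + p * (x - 1) ≤ x ^ p := by
  rw [Real.rpow_def_of_pos hx]
  have h1 := Real.add_one_le_exp (Real.log x * p)
  have h2 := Real.log_le_sub_one_of_pos hx
  nlinarith

/-- The tangent line at `1` of the concave function `x ↦ x ^ p`, `0 < p < 1`, lies above its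
graph. -/
theorem rpow_le_one_add_mul_sub_one {p x : ℝ} (hp : 0 < p) (hp1 : p < 1) (hx : 0 < x) :
    x ^ p ≤ 1 + p * (x - 1) := by
  have h := rpow_one_add_le_one_add_mul_self (s := x - 1) (by linarith) hp.le hp1.le
  simpa using h

/-- Among the positive definite `V` with `tr V⁻¹ ≤ tr 1`, the identity maximizes each of Kiefer's
criteria. -/
theorem kiefer_le_kiefer_one [Nonempty n] {p : WithBot ℝ} (hp : p < ((1 : ℝ) : WithBot ℝ))
    {V : Matrix n n ℝ} (hV : V.PosDef) (htr : trace V⁻¹ ≤ Fintype.card n) :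
    kiefer p V ≤ kiefer p (1 : Matrix n n ℝ) := by
  rw [trace_inv_eq_sum_inv_eigenvalues hV] at htr
  have hpos := hV.eigenvalues_pos
  set lam := hV.1.eigenvalues
  have hsub : ∑ i, ((lam i)⁻¹ - 1) ≤ 0 := by simpa using htr
  have hcard : (0 : ℝ) < Fintype.card n := by exact_mod_cast Fintype.card_pos
  induction p using WithBot.recBotCoe with
  | bot =>
    simp only [kiefer, inv_one, spectrum.one_eq, csInf_singleton]
    have h : ∑ _i : n, sInf (spectrum ℝ V⁻¹) ≤ ∑ i, (lam i)⁻¹ :=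
      Finset.sum_le_sum fun i _ => sInf_spectrum_inv_le hV i
    rw [Finset.sum_const, Finset.card_univ, nsmul_eq_mul] at h
    nlinarith
  | coe p =>
    have hp1 : p < 1 := by exact_mod_cast hp
    simp only [kiefer]
    split_ifs with h0
    · rw [inv_one, det_one, det_nonsing_inv, hV.1.det_eq_prod_eigenvalues, Ring.inverse_eq_inv']
      simp only [RCLike.ofReal_real_eq_id, id]
      rw [← Finset.prod_inv_distrib]
      calc ∏ i, (lam i)⁻¹ ≤ ∏ i, Real.exp ((lam i)⁻¹ - 1) :=
            Finset.prod_le_prod (fun i _ => (inv_pos.2 (hpos i)).le) fun i _ => by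
              simpa using Real.add_one_le_exp ((lam i)⁻¹ - 1)
        _ = Real.exp (∑ i, ((lam i)⁻¹ - 1)) := (Real.exp_sum _ _).symm
        _ ≤ 1 := Real.exp_le_one_iff.2 hsub
    · have hone : trace (cfc (fun x : ℝ => x ^ (-p)) (1 : Matrix n n ℝ)) = Fintype.card n := by
        rw [cfc_apply_one]
        simp
      have hsum : trace (cfc (fun x : ℝ => x ^ (-p)) V) = ∑ i, ((lam i)⁻¹) ^ p := by
        rw [trace_cfc_eq_sum_eigenvalues hV.1]
        exact Finset.sum_congr rfl fun i _ => by
          rw [Real.inv_rpow (hpos i).le, Real.rpow_neg (hpos i).le]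
      have htan : ∑ i, (1 + p * ((lam i)⁻¹ - 1)) =
          Fintype.card n + p * ∑ i, ((lam i)⁻¹ - 1) := by
        rw [Finset.sum_add_distrib, Finset.mul_sum]
        simp
      rw [hone, hsum]
      rcases lt_or_gt_of_ne h0 with hneg | hp0
      · refine Real.rpow_le_rpow_of_nonpos hcard ?_ (one_div_neg.2 hneg).le
        have h := Finset.sum_le_sum fun i (_ : i ∈ Finset.univ) =>
          one_add_mul_sub_one_le_rpow hneg (inv_pos.2 (hpos i))
        rw [htan] at h
        nlinarith
      · refine Real.rpow_le_rpow
          (Finset.sum_nonneg fun i _ => Real.rpow_nonneg (inv_pos.2 (hpos i)).le _) ?_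
          (one_div_pos.2 hp0).le
        have h := Finset.sum_le_sum fun i (_ : i ∈ Finset.univ) =>
          rpow_le_one_add_mul_sub_one hp0 hp1 (inv_pos.2 (hpos i))
        rw [htan] at h
        nlinarith

end Kiefer

/-! ### The information bound -/

section Information

theorem Estimable.exists_eq_mul {m n : Type*} [Fintype m] [Fintype n] [DecidableEq n]
    {K : Matrix m n ℝ} {M : Matrix m m ℝ}
    (h : Estimable K M) : ∃ L : Matrix m n ℝ, K = M * L := by
  have h' : ∀ j : n, ∃ v : m → ℝ, M *ᵥ v = K *ᵥ Pi.single j 1 := fun j => h ⟨Pi.single j 1, rfl⟩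
  choose v hv using h'
  refine ⟨Matrix.of fun i j => v j i, ?_⟩
  ext i j
  have := congrFun (hv j) i
  simp only [Matrix.mulVec_single_one] at this
  exact this.symm

variable {m n : Type*} [Fintype m] [Fintype n] [DecidableEq m] [DecidableEq n]

/-- If the columns of `K` are orthonormal and `Kᵀ c` is estimable under `M`, then
`V = Kᵀ M⁻ K` is positive definite and `tr V⁻¹ ≤ tr (Kᵀ M K)`. Writing `K = M L`, the difference
`Kᵀ M K - V⁻¹` is `Dᵀ M D` for `D = K - L V⁻¹`. -/
theorem posDef_and_trace_inv_le {K : Matrix m n ℝ} {M : Matrix m m ℝ} (hM : M.PosSemidef)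
    (hK : Estimable K M) (hKK : Kᵀ * K = 1) :
    (Kᵀ * genInverse M * K).PosDef ∧ trace (Kᵀ * genInverse M * K)⁻¹ ≤ trace (Kᵀ * M * K) := by
  obtain ⟨L, hL⟩ := hK.exists_eq_mul
  have hMt : Mᵀ = M := by simpa using hM.1.eq
  have hLK : Lᵀ * M = Kᵀ := by rw [hL, transpose_mul, hMt]
  have hV : Kᵀ * genInverse M * K = Lᵀ * M * L := by
    have h : M * genInverse M * M = M := isGenInverse_genInverse M
    rw [hL, transpose_mul, hMt]
    calc Lᵀ * M * genInverse M * (M * L) = Lᵀ * (M * genInverse M * M) * L := by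
          simp only [Matrix.mul_assoc]
      _ = Lᵀ * M * L := by rw [h]
  rw [hV]
  set V := Lᵀ * M * L with hVdef
  have hVpsd : V.PosSemidef := by
    simpa using hM.conjTranspose_mul_mul_same L
  have hVpd : V.PosDef := by
    refine hVpsd.posDef_iff_isUnit.2 ?_
    rw [← Matrix.mulVec_injective_iff_isUnit]
    refine (injective_iff_map_eq_zero V.mulVecLin).2 fun x hx => ?_
    have hx' : V *ᵥ x = 0 := hx
    have h1 : star (L *ᵥ x) ⬝ᵥ (M *ᵥ (L *ᵥ x)) = 0 := by
      have : x ⬝ᵥ (V *ᵥ x) = 0 := by rw [hx', dotProduct_zero]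
      rw [hVdef, ← mulVec_mulVec, ← mulVec_mulVec, dotProduct_mulVec, vecMul_transpose] at this
      simpa using this
    have h2 : K *ᵥ x = 0 := by
      rw [hL, ← mulVec_mulVec]
      exact (hM.dotProduct_mulVec_zero_iff _).1 h1
    calc x = (Kᵀ * K) *ᵥ x := by rw [hKK, one_mulVec]
      _ = 0 := by rw [← mulVec_mulVec, h2, mulVec_zero]
  refine ⟨hVpd, ?_⟩
  have hdet : IsUnit V.det := (isUnit_iff_isUnit_det V).1 hVpd.isUnit
  have hVt : V⁻¹ᵀ = V⁻¹ := by simpa using hVpd.1.inv.eq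
  have hD : (K - L * V⁻¹)ᵀ * M * (K - L * V⁻¹) = Kᵀ * M * K - V⁻¹ := by
    have e1 : Kᵀ * M * (L * V⁻¹) = V⁻¹ := by
      rw [← Matrix.mul_assoc, Matrix.mul_assoc Kᵀ, ← hL, hKK, Matrix.one_mul]
    have e2 : (L * V⁻¹)ᵀ * M = V⁻¹ * Kᵀ := by
      rw [transpose_mul, hVt, Matrix.mul_assoc, hLK]
    have e3 : V⁻¹ * Kᵀ * (L * V⁻¹) = V⁻¹ := by
      rw [← hLK]
      calc V⁻¹ * (Lᵀ * M) * (L * V⁻¹) = V⁻¹ * V * V⁻¹ := by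
            simp only [hVdef, Matrix.mul_assoc]
        _ = V⁻¹ := by rw [nonsing_inv_mul _ hdet, Matrix.one_mul]
    rw [transpose_sub, Matrix.sub_mul, e2, Matrix.sub_mul, Matrix.mul_sub, Matrix.mul_sub, e1, e3,
      Matrix.mul_assoc V⁻¹, hKK, Matrix.mul_one, sub_self, sub_zero]
  have htr : 0 ≤ trace ((K - L * V⁻¹)ᵀ * M * (K - L * V⁻¹)) := by
    simpa using (hM.conjTranspose_mul_mul_same (K - L * V⁻¹)).trace_nonneg
  rw [hD, trace_sub] at htr
  linarith

end Information

/-! ### Derivatives of the Legendre polynomials -/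

section Legendre

open Polynomial

/-- The `m`-th derivative `P_n^{(m)}` of the `n`-th Legendre polynomial, as given by Rodrigues'
formula. -/
def legendreDeriv (n m : ℕ) : ℝ[X] :=
  C (1 / (2 ^ n * (n.factorial : ℝ))) * derivative^[n + m] ((X ^ 2 - 1) ^ n)

theorem derivative_legendreDeriv (n m : ℕ) :
    derivative (legendreDeriv n m) = legendreDeriv n (m + 1) := by
  rw [legendreDeriv, derivative_C_mul, ← Function.iterate_succ_apply' derivative]
  rfl

theorem legendreDeriv_eq_zero {n m : ℕ} (h : n < m) : legendreDeriv n m = 0 := by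
  rw [legendreDeriv, iterate_derivative_eq_zero, mul_zero]
  calc ((X ^ 2 - 1 : ℝ[X]) ^ n).natDegree ≤ n * (X ^ 2 - 1 : ℝ[X]).natDegree := natDegree_pow_le
    _ = n * 2 := by rw [show (X ^ 2 - 1 : ℝ[X]) = X ^ 2 - C 1 by simp, natDegree_X_pow_sub_C]
    _ < n + m := by lia

theorem derivative_sq_sub_one : derivative (X ^ 2 - 1 : ℝ[X]) = 2 * X := by
  simpa [one_add_one_eq_two] using map_ofNat (C : ℝ →+* ℝ[X]) 2

/-- Differentiating `(x² - 1) w' = 2 n x w`, `w = (x² - 1)^n`, a total of `k + 1` times. -/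
theorem iterate_derivative_sq_sub_one_pow (n k : ℕ) :
    (X ^ 2 - 1) * derivative^[k + 2] ((X ^ 2 - 1 : ℝ[X]) ^ n) +
      C (2 * ((k : ℝ) + 1 - n)) * X * derivative^[k + 1] ((X ^ 2 - 1 : ℝ[X]) ^ n) +
      C (((k : ℝ) + 1) * (k - 2 * n)) * derivative^[k] ((X ^ 2 - 1 : ℝ[X]) ^ n) = 0 := by
  induction k with
  | zero =>
    have h : (X ^ 2 - 1 : ℝ[X]) * derivative ((X ^ 2 - 1 : ℝ[X]) ^ n) =
        C (2 * (n : ℝ)) * X * (X ^ 2 - 1 : ℝ[X]) ^ n := by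
      rcases n with _ | n
      · simp
      · rw [derivative_pow, derivative_sq_sub_one]
        simp only [map_mul, map_natCast, map_ofNat, Nat.add_sub_cancel]
        ring
    have h' := congrArg derivative h
    simp only [derivative_mul, derivative_sq_sub_one, derivative_C, derivative_X] at h'
    simp only [Function.iterate_succ, Function.iterate_zero, Function.comp_apply, id]
    simp only [map_mul, map_sub, map_add, map_natCast, map_ofNat, map_one, Nat.cast_zero,
      map_zero] at h' ⊢
    linear_combination h'
  | succ k ih =>
    have h' := congrArg derivative ih
    simp only [derivative_add, derivative_mul, derivative_sq_sub_one,
      derivative_C, derivative_X, ← Function.iterate_succ_apply' derivative] at h'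
    simp only [map_mul, map_sub, map_add, map_natCast, map_ofNat, map_one, Nat.cast_succ,
      Nat.succ_eq_add_one, map_zero] at h' ⊢
    linear_combination h'

/-- Legendre's differential equation, differentiated `m` times. -/
theorem legendreDeriv_ode (n m : ℕ) :
    (1 - X ^ 2) * legendreDeriv n (m + 2) - C (2 * ((m : ℝ) + 1)) * X * legendreDeriv n (m + 1) +
      C (((n : ℝ) - m) * (n + m + 1)) * legendreDeriv n m = 0 := by
  have h := iterate_derivative_sq_sub_one_pow n (n + m)
  simp only [legendreDeriv, ← add_assoc]
  simp only [map_mul, map_sub, map_add, map_natCast, map_ofNat, map_one, Nat.cast_add] at h ⊢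
  linear_combination (-C (1 / (2 ^ n * (n.factorial : ℝ)))) * h

theorem legendreDeriv_zero_eval_one (n : ℕ) : (legendreDeriv n 0).eval 1 = 1 := by
  have hf : (X ^ 2 - 1 : ℝ[X]) ^ n = (X - C 1) ^ n * (X + C 1) ^ n := by
    rw [← mul_pow]; congr 1; simp; ring
  have h : (derivative^[n] ((X ^ 2 - 1 : ℝ[X]) ^ n)).eval 1 = n.factorial * 2 ^ n := by
    -- in Leibniz' rule only the term with all `n` derivatives on `(X - 1) ^ n` survives at `1`
    rw [hf, iterate_derivative_mul, eval_finsetSum, Finset.sum_eq_single 0]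
    · rw [Nat.sub_zero, iterate_derivative_X_sub_pow_self]
      simp
      norm_num
    · intro k hk hk0
      have hlt : n - (n - k) ≠ 0 := by
        have := Finset.mem_range.1 hk
        lia
      rw [iterate_derivative_X_sub_pow]
      simp [hlt]
    · simp
  rw [legendreDeriv, eval_mul, add_zero, h, eval_C]
  field_simp

/-- The weight `(n - m)! / (n + m)!` of order `m` in the addition theorem. -/
def orderWeight (n m : ℕ) : ℝ := ((n - m).factorial : ℝ) / ((n + m).factorial : ℝ)

theorem orderWeight_zero (n : ℕ) : orderWeight n 0 = 1 := by
  simp [orderWeight, Nat.factorial_ne_zero]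

theorem orderWeight_eq_succ_mul {n m : ℕ} (h : m < n) :
    orderWeight n m = orderWeight n (m + 1) * (((n : ℝ) - m) * (n + m + 1)) := by
  obtain ⟨j, rfl⟩ := Nat.exists_eq_add_of_lt h
  rw [orderWeight, orderWeight, show m + j + 1 - m = j + 1 by lia,
    show m + j + 1 - (m + 1) = j by lia,
    show m + j + 1 + (m + 1) = (m + j + 1 + m) + 1 by lia, Nat.factorial_succ j,
    Nat.factorial_succ (m + j + 1 + m)]
  push_cast
  have : ((m + j + 1 + m).factorial : ℝ) ≠ 0 := by positivity
  have : (m : ℝ) + j + 1 + m + 1 ≠ 0 := by positivity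
  field_simp
  ring

/-- The summand of order `m` in the addition theorem, as a polynomial in `x = cos θ`. -/
def legendreSq (n m : ℕ) : ℝ[X] :=
  C (orderWeight n m) * (1 - X ^ 2) ^ m * legendreDeriv n m ^ 2

/-- The flux whose differences are the derivatives of the summands `legendreSq`. -/
def legendreFlux (n m : ℕ) : ℝ[X] :=
  C (orderWeight n m) * (1 - X ^ 2) ^ m * (legendreDeriv n m * legendreDeriv n (m + 1))

theorem derivative_legendreSq_zero (n : ℕ) :
    derivative (legendreSq n 0) = 2 * legendreFlux n 0 := by
  simp only [legendreSq, legendreFlux, orderWeight_zero, derivative_mul, derivative_pow,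
    derivative_legendreDeriv]
  simp [map_ofNat, mul_assoc]

theorem derivative_legendreSq_succ {n m : ℕ} (h : m < n) :
    derivative (legendreSq n (m + 1)) = legendreFlux n (m + 1) - legendreFlux n m := by
  have hode := legendreDeriv_ode n m
  simp only [legendreSq, legendreFlux, orderWeight_eq_succ_mul h, derivative_mul, derivative_pow,
    derivative_legendreDeriv, derivative_sub, derivative_one, derivative_X, derivative_C]
  simp only [map_mul, map_sub, map_add, map_natCast, map_ofNat, map_one, Nat.cast_succ,
    add_tsub_cancel_right] at hode ⊢
  simp only [Nat.add_one_sub_one, show m + 1 + 1 = m + 2 from rfl]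
  linear_combination (C (orderWeight n (m + 1)) * (1 - X ^ 2) ^ m * legendreDeriv n (m + 1)) * hode

/-- The addition theorem on the diagonal, `P_n² + 2 ∑_{m ≥ 1} (n-m)!/(n+m)! (P_n^m)² = 1`: the
derivative of the left side telescopes to zero, and `P_n(1) = 1`. -/
theorem legendreSq_sum (n : ℕ) :
    legendreSq n 0 + 2 * ∑ m ∈ Finset.range n, legendreSq n (m + 1) = 1 := by
  set Q := legendreSq n 0 + 2 * ∑ m ∈ Finset.range n, legendreSq n (m + 1) with hQ
  have hd : derivative Q = 0 := by
    have h2 : derivative (2 : ℝ[X]) = 0 := derivative_ofNat 2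
    rw [hQ, derivative_add, derivative_mul, h2, zero_mul, zero_add, derivative_sum,
      Finset.sum_congr rfl fun m hm => derivative_legendreSq_succ (Finset.mem_range.1 hm),
      Finset.sum_range_sub, derivative_legendreSq_zero]
    have : legendreFlux n n = 0 := by
      rw [legendreFlux, legendreDeriv_eq_zero (Nat.lt_succ_self n), mul_zero, mul_zero]
    rw [this]
    ring
  have hC : Q = C (Q.coeff 0) := eq_C_of_derivative_eq_zero hd
  have h1 : Q.eval 1 = 1 := by
    rw [hQ, eval_add, eval_mul, eval_finsetSum, Finset.sum_eq_zero]
    · simp [legendreSq, orderWeight_zero, legendreDeriv_zero_eval_one]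
    · intro m _
      simp [legendreSq]
  rw [hC, eval_C] at h1
  rw [hC, h1, map_one]

/-- The inner product `∫ (1 - x²)^m P_n^{(m)} P_k^{(m)} dx` over `[-1, 1]`. -/
def legendreInner (n k m : ℕ) : ℝ :=
  ∫ x in (-1 : ℝ)..1, ((1 - X ^ 2) ^ m * (legendreDeriv n m * legendreDeriv k m)).eval x

theorem legendreInner_comm (n k m : ℕ) : legendreInner n k m = legendreInner k n m := by
  unfold legendreInner
  rw [mul_comm (legendreDeriv n m)]

theorem integral_eval_derivative (Q : ℝ[X]) (a b : ℝ) :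
    ∫ x in a..b, (derivative Q).eval x = Q.eval b - Q.eval a :=
  intervalIntegral.integral_eq_sub_of_hasDerivAt (fun x _ => Q.hasDerivAt x)
    ((derivative Q).continuous.intervalIntegrable _ _)

/-- Integration by parts and the differential equation lower the order by one. -/
theorem legendreInner_succ (n k m : ℕ) :
    legendreInner n k (m + 1) = (((k : ℝ) - m) * (k + m + 1)) * legendreInner n k m := by
  have hB := integral_eval_derivative
    ((1 - X ^ 2) ^ (m + 1) * (legendreDeriv n m * legendreDeriv k (m + 1))) (-1) 1
  have hpoly : derivative ((1 - X ^ 2) ^ (m + 1) *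
        (legendreDeriv n m * legendreDeriv k (m + 1))) =
      (1 - X ^ 2) ^ (m + 1) * (legendreDeriv n (m + 1) * legendreDeriv k (m + 1)) -
      C (((k : ℝ) - m) * (k + m + 1)) *
        ((1 - X ^ 2) ^ m * (legendreDeriv n m * legendreDeriv k m)) := by
    have hode := legendreDeriv_ode k m
    simp only [derivative_mul, derivative_pow, derivative_legendreDeriv, derivative_sub,
      derivative_one, derivative_X]
    simp only [map_mul, map_sub, map_add, map_natCast, map_ofNat, map_one, Nat.cast_succ,
      add_tsub_cancel_right] at hode ⊢
    simp only [Nat.add_one_sub_one, show m + 1 + 1 = m + 2 from rfl]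
    linear_combination ((1 - X ^ 2) ^ m * legendreDeriv n m) * hode
  rw [hpoly] at hB
  simp only [eval_sub, eval_mul (p := C _), eval_C] at hB
  rw [intervalIntegral.integral_sub, intervalIntegral.integral_const_mul] at hB
  · simp at hB
    unfold legendreInner
    simp only [eval_mul, eval_pow, eval_sub, eval_one, eval_X]
    linarith
  · exact (Polynomial.continuous _).intervalIntegrable _ _
  · exact (continuous_const.mul (Polynomial.continuous _)).intervalIntegrable _ _

/-- For `m = 0`, the recursion and its mirror image in `n` and `k` express the same inner product
through the distinct eigenvalues `k (k + 1)` and `n (n + 1)`. -/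
theorem legendreInner_of_ne {n k : ℕ} (h : n ≠ k) (m : ℕ) : legendreInner n k m = 0 := by
  induction m with
  | zero =>
    have h1 := legendreInner_succ n k 0
    have h2 := legendreInner_succ k n 0
    rw [legendreInner_comm k n, legendreInner_comm k n, h1] at h2
    have hne : ((n : ℝ) - k) * (n + k + 1) ≠ 0 :=
      mul_ne_zero (sub_ne_zero.2 (by exact_mod_cast h)) (by positivity)
    refine (mul_eq_zero.1 ?_).resolve_left hne
    push_cast at h2
    linear_combination -h2
  | succ m ih => rw [legendreInner_succ, ih, mul_zero]

theorem orderWeight_mul_legendreInner {n m : ℕ} (h : m ≤ n) :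
    orderWeight n m * legendreInner n n m = legendreInner n n 0 := by
  induction m with
  | zero => rw [orderWeight_zero, one_mul]
  | succ m ih =>
    rw [← ih (by lia), legendreInner_succ, orderWeight_eq_succ_mul (by lia : m < n)]
    ring

theorem integral_legendreSq {n m : ℕ} (h : m ≤ n) :
    ∫ x in (-1 : ℝ)..1, (legendreSq n m).eval x = legendreInner n n 0 := by
  rw [← orderWeight_mul_legendreInner h, legendreInner, ← intervalIntegral.integral_const_mul]
  congr 1
  ext x
  simp only [legendreSq, eval_mul, eval_C, eval_pow]
  ring

/-- Integrating the addition theorem: its `2 n + 1` summands have equal integrals. -/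
theorem legendreInner_self_zero (n : ℕ) : (2 * (n : ℝ) + 1) * legendreInner n n 0 = 2 := by
  have h : ∫ x in (-1 : ℝ)..1,
      (legendreSq n 0 + 2 * ∑ m ∈ Finset.range n, legendreSq n (m + 1)).eval x = 2 := by
    rw [legendreSq_sum]; norm_num
  simp only [eval_add, eval_mul, eval_ofNat, eval_finsetSum] at h
  rw [intervalIntegral.integral_add, intervalIntegral.integral_const_mul,
    intervalIntegral.integral_finsetSum, integral_legendreSq (Nat.zero_le n),
    Finset.sum_congr rfl fun m hm => integral_legendreSq (Finset.mem_range.1 hm)] at h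
  · simp only [Finset.sum_const, Finset.card_range, nsmul_eq_mul] at h
    linarith
  · exact fun m _ => (Polynomial.continuous _).intervalIntegrable _ _
  · exact (Polynomial.continuous _).intervalIntegrable _ _
  · exact (continuous_const.mul
      (continuous_finsetSum _ fun m _ => Polynomial.continuous _)).intervalIntegrable _ _

theorem assocLegendre_eq (n m : ℕ) (x : ℝ) :
    assocLegendre n m x = (-1) ^ m * √(1 - x ^ 2) ^ m * (legendreDeriv n m).eval x := by
  simp only [assocLegendre, legendreDeriv, eval_mul, eval_C]
  ring

theorem assocLegendre_mul_assocLegendre (n k m : ℕ) {x : ℝ} (hx : x ^ 2 ≤ 1) :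
    assocLegendre n m x * assocLegendre k m x =
      ((1 - X ^ 2) ^ m * (legendreDeriv n m * legendreDeriv k m)).eval x := by
  have h1 : √(1 - x ^ 2) ^ m * √(1 - x ^ 2) ^ m = (1 - x ^ 2) ^ m := by
    rw [← mul_pow, Real.mul_self_sqrt (by linarith)]
  have h2 : ((-1 : ℝ) ^ m) * (-1) ^ m = 1 := by rw [← mul_pow]; simp
  rw [assocLegendre_eq, assocLegendre_eq]
  simp only [eval_mul, eval_pow, eval_sub, eval_one, eval_X]
  linear_combination ((legendreDeriv n m).eval x * (legendreDeriv k m).eval x) *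
    (h1 + √(1 - x ^ 2) ^ m * √(1 - x ^ 2) ^ m * h2)

end Legendre

/-! ### The azimuthal factor -/

section Azimuthal

theorem azimuthal_zero (φ : ℝ) : azimuthal 0 φ = 1 := by simp [azimuthal]

theorem azimuthal_of_pos {m : ℤ} (h : 0 < m) (φ : ℝ) :
    azimuthal m φ = √2 * Real.cos (m * φ) := by
  simp [azimuthal, h]

theorem azimuthal_of_neg {m : ℤ} (h : m < 0) (φ : ℝ) :
    azimuthal m φ = -(√2 * Real.sin (m * φ)) := by
  have h' : ((m.natAbs : ℕ) : ℝ) = -(m : ℝ) := by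
    rw [Nat.cast_natAbs, abs_of_neg h, Int.cast_neg]
  simp [azimuthal, h.not_gt, h.ne, h']

theorem continuous_azimuthal (m : ℤ) : Continuous (azimuthal m) := by
  unfold azimuthal
  split_ifs <;> fun_prop

theorem azimuthal_sq_add_azimuthal_neg_sq {m : ℤ} (h : 0 < m) (φ : ℝ) :
    azimuthal m φ ^ 2 + azimuthal (-m) φ ^ 2 = 2 := by
  rw [azimuthal_of_pos h, azimuthal_of_neg (neg_lt_zero.2 h)]
  have h2 : √(2 : ℝ) ^ 2 = 2 := Real.sq_sqrt (by norm_num)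
  push_cast
  rw [neg_mul, Real.sin_neg]
  linear_combination 2 * Real.sin_sq_add_cos_sq (m * φ) +
    (Real.sin (m * φ) ^ 2 + Real.cos (m * φ) ^ 2) * h2

theorem integral_cos_intCast_mul (k : ℤ) :
    ∫ φ in -Real.pi..Real.pi, Real.cos (k * φ) = if k = 0 then 2 * Real.pi else 0 := by
  split_ifs with h
  · subst h
    simp
    ring
  · have hk : (k : ℝ) ≠ 0 := by exact_mod_cast h
    rw [intervalIntegral.integral_comp_mul_left (fun x => Real.cos x) hk, integral_cos]
    simp [Real.sin_int_mul_pi]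

theorem integral_sin_intCast_mul (k : ℤ) :
    ∫ φ in -Real.pi..Real.pi, Real.sin (k * φ) = 0 := by
  by_cases h : k = 0
  · simp [h]
  · have hk : (k : ℝ) ≠ 0 := by exact_mod_cast h
    rw [intervalIntegral.integral_comp_mul_left (fun x => Real.sin x) hk, integral_sin]
    simp

theorem integral_azimuthal_mul_azimuthal (m k : ℤ) :
    ∫ φ in -Real.pi..Real.pi, azimuthal m φ * azimuthal k φ =
      if m = k then 2 * Real.pi else 0 := by
  have h2 : √(2 : ℝ) * √2 = 2 := Real.mul_self_sqrt (by norm_num)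
  have hc : ∀ j : ℤ, IntervalIntegrable (fun φ : ℝ => Real.cos (j * φ)) volume
      (-Real.pi) Real.pi := fun j => Continuous.intervalIntegrable (by fun_prop) _ _
  have hs : ∀ j : ℤ, IntervalIntegrable (fun φ : ℝ => Real.sin (j * φ)) volume
      (-Real.pi) Real.pi := fun j => Continuous.intervalIntegrable (by fun_prop) _ _
  -- mixed products are combinations of sines
  have hmix : ∀ {m k : ℤ}, 0 < m → k < 0 →
      ∫ φ in -Real.pi..Real.pi, azimuthal m φ * azimuthal k φ = 0 := by
    intro m k hm hk
    have e : ∀ φ, azimuthal m φ * azimuthal k φ =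
        Real.sin ((m - k : ℤ) * φ) - Real.sin ((m + k : ℤ) * φ) := fun φ => by
      rw [azimuthal_of_pos hm, azimuthal_of_neg hk]
      push_cast
      rw [sub_mul, add_mul, Real.sin_sub, Real.sin_add]
      linear_combination (-Real.cos (m * φ) * Real.sin (k * φ)) * h2
    simp_rw [e]
    rw [intervalIntegral.integral_sub (hs _) (hs _), integral_sin_intCast_mul,
      integral_sin_intCast_mul, sub_zero]
  have hzero : ∀ {k : ℤ}, k ≠ 0 →
      ∫ φ in -Real.pi..Real.pi, azimuthal 0 φ * azimuthal k φ = 0 := by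
    intro k hk
    simp_rw [azimuthal_zero, one_mul]
    rcases lt_or_gt_of_ne hk with h | h
    · simp_rw [azimuthal_of_neg h]
      rw [intervalIntegral.integral_neg, intervalIntegral.integral_const_mul,
        integral_sin_intCast_mul, mul_zero, neg_zero]
    · simp_rw [azimuthal_of_pos h]
      rw [intervalIntegral.integral_const_mul, integral_cos_intCast_mul, if_neg hk, mul_zero]
  rcases lt_trichotomy m 0 with hm | rfl | hm <;> rcases lt_trichotomy k 0 with hk | rfl | hk
  · have e : ∀ φ, azimuthal m φ * azimuthal k φ =
        Real.cos ((m - k : ℤ) * φ) - Real.cos ((m + k : ℤ) * φ) := fun φ => by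
      rw [azimuthal_of_neg hm, azimuthal_of_neg hk]
      push_cast
      rw [sub_mul, add_mul, Real.cos_sub, Real.cos_add]
      linear_combination (Real.sin (m * φ) * Real.sin (k * φ)) * h2
    simp_rw [e]
    rw [intervalIntegral.integral_sub (hc _) (hc _), integral_cos_intCast_mul,
      integral_cos_intCast_mul, if_neg (by lia : ¬ m + k = 0), sub_zero]
    simp [sub_eq_zero]
  · simp_rw [mul_comm (azimuthal m _)]
    rw [hzero hm.ne, if_neg hm.ne]
  · simp_rw [mul_comm (azimuthal m _)]
    rw [hmix hk hm, if_neg (by lia)]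
  · rw [hzero hk.ne, if_neg hk.ne']
  · simp [azimuthal_zero]
    ring
  · rw [hzero hk.ne', if_neg hk.ne]
  · rw [hmix hm hk, if_neg (by lia)]
  · simp_rw [mul_comm (azimuthal m _)]
    rw [hzero hm.ne', if_neg hm.ne']
  · have e : ∀ φ, azimuthal m φ * azimuthal k φ =
        Real.cos ((m - k : ℤ) * φ) + Real.cos ((m + k : ℤ) * φ) := fun φ => by
      rw [azimuthal_of_pos hm, azimuthal_of_pos hk]
      push_cast
      rw [sub_mul, add_mul, Real.cos_sub, Real.cos_add]
      linear_combination (Real.cos (m * φ) * Real.cos (k * φ)) * h2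
    simp_rw [e]
    rw [intervalIntegral.integral_add (hc _) (hc _), integral_cos_intCast_mul,
      integral_cos_intCast_mul, if_neg (by lia : ¬ m + k = 0), add_zero]
    simp [sub_eq_zero]

end Azimuthal

/-! ### The addition theorem for spherical harmonics -/

section Harmonic

theorem sum_Icc_neg_eq {M : Type*} [AddCommGroup M] (g : ℤ → M) (n : ℕ) :
    ∑ m ∈ Finset.Icc (-(n : ℤ)) n, g m =
      g 0 + ∑ j ∈ Finset.range n, (g ((j + 1 : ℕ) : ℤ) + g (-((j + 1 : ℕ) : ℤ))) := by
  induction n with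
  | zero => simp
  | succ n ih =>
    have h := Finset.sum_Icc_succ_eq_add_endpoints g (N := n)
    rw [Finset.sum_range_succ, ← add_assoc, ← ih]
    push_cast at h ⊢
    rw [h, add_comm]

theorem sphHarmonic_sq (n : ℕ) (m : ℤ) (θ φ : ℝ) :
    sphHarmonic n m θ φ ^ 2 =
      (2 * (n : ℝ) + 1) * (legendreSq n m.natAbs).eval (Real.cos θ) * azimuthal m φ ^ 2 := by
  have hP := assocLegendre_mul_assocLegendre n n m.natAbs (Real.cos_sq_le_one θ)
  have hN : (0 : ℝ) ≤ (2 * (n : ℝ) + 1) * ((n - m.natAbs).factorial : ℝ) /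
      ((n + m.natAbs).factorial : ℝ) := by positivity
  rw [sphHarmonic, mul_pow, mul_pow, Real.sq_sqrt hN, sq (assocLegendre _ _ _), hP, legendreSq,
    orderWeight]
  simp only [Polynomial.eval_mul, Polynomial.eval_C, Polynomial.eval_pow]
  ring

/-- Unsöld's theorem: the squares of the harmonics of level `n` add up to the constant
`2 n + 1`. -/
theorem sum_sphHarmonic_sq (n : ℕ) (θ φ : ℝ) :
    ∑ m : Order n, sphHarmonic n m θ φ ^ 2 = 2 * (n : ℝ) + 1 := by
  rw [Finset.sum_coe_sort (Finset.Icc (-(n : ℤ)) (n : ℤ)) fun m => sphHarmonic n m θ φ ^ 2,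
    sum_Icc_neg_eq]
  have h := congrArg (Polynomial.eval (Real.cos θ)) (legendreSq_sum n)
  simp only [Polynomial.eval_add, Polynomial.eval_mul, Polynomial.eval_ofNat,
    Polynomial.eval_finsetSum, Polynomial.eval_one] at h
  have hj : ∀ j : ℕ, sphHarmonic n ((j + 1 : ℕ) : ℤ) θ φ ^ 2 +
      sphHarmonic n (-((j + 1 : ℕ) : ℤ)) θ φ ^ 2 =
      (2 * (n : ℝ) + 1) * 2 * (legendreSq n (j + 1)).eval (Real.cos θ) := fun j => by
    have ha := azimuthal_sq_add_azimuthal_neg_sq (m := ((j + 1 : ℕ) : ℤ)) (by positivity) φ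
    rw [sphHarmonic_sq, sphHarmonic_sq, Int.natAbs_neg, Int.natAbs_natCast]
    linear_combination ((2 * (n : ℝ) + 1) * (legendreSq n (j + 1)).eval (Real.cos θ)) * ha
  rw [Finset.sum_congr rfl fun j _ => hj j, ← Finset.mul_sum, sphHarmonic_sq, azimuthal_zero,
    Int.natAbs_zero]
  linear_combination (2 * (n : ℝ) + 1) * h

theorem sphHarmonic_sq_le (n : ℕ) (m : Order n) (θ φ : ℝ) :
    sphHarmonic n m θ φ ^ 2 ≤ 2 * (n : ℝ) + 1 := by
  rw [← sum_sphHarmonic_sq n θ φ]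
  exact Finset.single_le_sum (f := fun m : Order n => sphHarmonic n m θ φ ^ 2)
    (fun _ _ => sq_nonneg _) (Finset.mem_univ m)

theorem continuous_regressionVec {d : ℕ} (a : CoeffIndex d) :
    Continuous fun z => regressionVec d z a := by
  have h1 : Continuous fun z : ℝ × ℝ => azimuthal (a.2 : ℤ) z.2 :=
    (continuous_azimuthal _).comp continuous_snd
  have h2 : Continuous fun z : ℝ × ℝ => assocLegendre a.1 (a.2 : ℤ).natAbs (Real.cos z.1) := by
    unfold assocLegendre
    exact (by fun_prop : Continuous fun z : ℝ × ℝ => _ * (√(1 - Real.cos z.1 ^ 2)) ^ _).mul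
      ((Polynomial.continuous _).comp (by fun_prop))
  exact (continuous_const.mul h2).mul h1

end Harmonic

/-! ### The information matrix of the uniform design -/

section Uniform

open Polynomial in
/-- The substitution `x = cos θ`. -/
theorem integral_sin_mul_eval_cos (Q : ℝ[X]) :
    ∫ θ in (0 : ℝ)..Real.pi, Real.sin θ * Q.eval (Real.cos θ) =
      ∫ x in (-1 : ℝ)..1, Q.eval x := by
  have h := intervalIntegral.integral_comp_mul_deriv (a := 0) (b := Real.pi) (f := Real.cos)
    (f' := fun θ => -Real.sin θ) (g := fun x => Q.eval x) (fun θ _ => Real.hasDerivAt_cos θ)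
    (by fun_prop) Q.continuous
  rw [Real.cos_zero, Real.cos_pi, intervalIntegral.integral_symm (-1) 1] at h
  rw [← neg_inj, ← h, ← intervalIntegral.integral_neg]
  congr 1
  ext θ
  simp only [Function.comp_apply]
  ring

theorem integral_uniformDesign (f : ℝ × ℝ → ℝ) :
    ∫ z, f z ∂uniformDesign =
      ∫ z in designRegion, 1 / (4 * Real.pi) * Real.sin z.1 * f z := by
  have hmeas : MeasurableSet designRegion := measurableSet_Icc.prod measurableSet_Ioc
  rw [uniformDesign, integral_withDensity_eq_integral_toReal_smul (by fun_prop)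
    (Filter.Eventually.of_forall fun _ => ENNReal.ofReal_lt_top)]
  refine setIntegral_congr_fun hmeas fun z hz => ?_
  have hsin : 0 ≤ Real.sin z.1 := Real.sin_nonneg_of_mem_Icc hz.1
  have hnn : 0 ≤ 1 / (4 * Real.pi) * Real.sin z.1 := by positivity
  simp only [ENNReal.toReal_ofReal hnn, smul_eq_mul]

theorem integral_uniformDesign_mul (f g : ℝ → ℝ) :
    ∫ z, f z.1 * g z.2 ∂uniformDesign =
      1 / (4 * Real.pi) * (∫ θ in (0 : ℝ)..Real.pi, Real.sin θ * f θ) *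
        ∫ φ in -Real.pi..Real.pi, g φ := by
  have hpi := Real.pi_pos
  rw [integral_uniformDesign]
  have e : ∀ z : ℝ × ℝ, 1 / (4 * Real.pi) * Real.sin z.1 * (f z.1 * g z.2) =
      (1 / (4 * Real.pi) * (Real.sin z.1 * f z.1)) * g z.2 := fun z => by ring
  simp_rw [e]
  rw [designRegion, Measure.volume_eq_prod,
    setIntegral_prod_mul (fun θ => 1 / (4 * Real.pi) * (Real.sin θ * f θ)) g,
    integral_Icc_eq_integral_Ioc, ← intervalIntegral.integral_of_le hpi.le,
    ← intervalIntegral.integral_of_le (by linarith), intervalIntegral.integral_const_mul]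

/-- The spherical harmonics are orthonormal for the uniform distribution. -/
theorem integral_sphHarmonic_mul (n k : ℕ) (m : Order n) (l : Order k) :
    ∫ z, sphHarmonic n m z.1 z.2 * sphHarmonic k l z.1 z.2 ∂uniformDesign =
      if n = k ∧ (m : ℤ) = l then 1 else 0 := by
  obtain ⟨m, hm⟩ := m
  obtain ⟨l, hl⟩ := l
  set N : ℕ → ℤ → ℝ := fun n m =>
    √((2 * (n : ℝ) + 1) * ((n - m.natAbs).factorial : ℝ) / ((n + m.natAbs).factorial : ℝ)) with hN
  have e : ∀ z : ℝ × ℝ, sphHarmonic n m z.1 z.2 * sphHarmonic k l z.1 z.2 =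
      (N n m * N k l * (assocLegendre n m.natAbs (Real.cos z.1) *
        assocLegendre k l.natAbs (Real.cos z.1))) * (azimuthal m z.2 * azimuthal l z.2) :=
    fun z => by
      simp only [sphHarmonic, hN]
      ring
  simp only [e]
  rw [integral_uniformDesign_mul (fun θ => N n m * N k l * (assocLegendre n m.natAbs (Real.cos θ) *
    assocLegendre k l.natAbs (Real.cos θ))) fun φ => azimuthal m φ * azimuthal l φ,
    integral_azimuthal_mul_azimuthal]
  by_cases hml : m = l
  swap
  · simp [hml]
  subst hml
  have e2 : ∀ θ : ℝ, Real.sin θ * (N n m * N k m * (assocLegendre n m.natAbs (Real.cos θ) *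
      assocLegendre k m.natAbs (Real.cos θ))) = N n m * N k m * (Real.sin θ *
      ((1 - Polynomial.X ^ 2) ^ m.natAbs * (legendreDeriv n m.natAbs *
        legendreDeriv k m.natAbs)).eval (Real.cos θ)) := fun θ => by
    rw [assocLegendre_mul_assocLegendre _ _ _ (Real.cos_sq_le_one θ)]
    ring
  simp_rw [e2]
  rw [intervalIntegral.integral_const_mul, integral_sin_mul_eval_cos, ← legendreInner]
  by_cases hnk : n = k
  swap
  · simp [hnk, legendreInner_of_ne hnk]
  subst hnk
  have hle : m.natAbs ≤ n := by
    rw [Finset.mem_Icc] at hm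
    lia
  have hNN : N n m * N n m = (2 * (n : ℝ) + 1) * orderWeight n m.natAbs := by
    rw [hN]
    simp only
    rw [Real.mul_self_sqrt (by positivity), orderWeight, mul_div_assoc]
  rw [hNN, mul_assoc (2 * (n : ℝ) + 1), orderWeight_mul_legendreInner hle,
    legendreInner_self_zero]
  have := Real.pi_ne_zero
  simp
  field_simp
  norm_num

theorem infoMatrix_uniformDesign (d : ℕ) : infoMatrix d uniformDesign = 1 := by
  ext ⟨n, m⟩ ⟨k, l⟩
  simp only [infoMatrix, of_apply, regressionVec, Matrix.one_apply]
  rw [integral_sphHarmonic_mul]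
  congr 1
  rw [eq_iff_iff]
  constructor
  · rintro ⟨h1, h2⟩
    obtain rfl := Fin.ext h1
    obtain rfl := Subtype.ext h2
    rfl
  · rintro h
    cases h
    exact ⟨rfl, rfl⟩

theorem isDesign_uniformDesign : IsDesign uniformDesign where
  isProbabilityMeasure := by
    have h0 : (0 : ℤ) ∈ Finset.Icc (-((0 : ℕ) : ℤ)) ((0 : ℕ) : ℤ) := by simp
    -- the constant `1` is the harmonic of level zero
    have h := integral_sphHarmonic_mul 0 0 ⟨0, h0⟩ ⟨0, h0⟩
    have hone : ∀ θ φ, sphHarmonic 0 0 θ φ = 1 := fun θ φ => by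
      simp [sphHarmonic, assocLegendre, azimuthal_zero]
    simp only [hone, mul_one, integral_const, smul_eq_mul, and_self, if_true] at h
    refine ⟨?_⟩
    rwa [Measure.real, ENNReal.toReal_eq_one_iff] at h
  compl_null := by
    refine withDensity_absolutelyContinuous _ _ ?_
    have hmeas : MeasurableSet designRegion := measurableSet_Icc.prod measurableSet_Ioc
    rw [Measure.restrict_apply hmeas.compl]
    simp

end Uniform

/-! ### Information matrices of general designs -/

section Design

variable {d : ℕ} {ξ : Measure (ℝ × ℝ)}

theorem integrable_regressionVec_mul [IsFiniteMeasure ξ] (a b : CoeffIndex d) :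
    Integrable (fun z => regressionVec d z a * regressionVec d z b) ξ := by
  refine Integrable.of_bound
    ((continuous_regressionVec a).mul (continuous_regressionVec b)).aestronglyMeasurable
    ((2 * (a.1 : ℝ) + 1) + (2 * (b.1 : ℝ) + 1)) (Filter.Eventually.of_forall fun z => ?_)
  have ha : regressionVec d z a ^ 2 ≤ 2 * (a.1 : ℝ) + 1 := sphHarmonic_sq_le a.1 a.2 z.1 z.2
  have hb : regressionVec d z b ^ 2 ≤ 2 * (b.1 : ℝ) + 1 := sphHarmonic_sq_le b.1 b.2 z.1 z.2
  rw [Real.norm_eq_abs, abs_le]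
  constructor <;> nlinarith [sq_nonneg (regressionVec d z a + regressionVec d z b),
    sq_nonneg (regressionVec d z a - regressionVec d z b)]

theorem posSemidef_infoMatrix [IsFiniteMeasure ξ] : (infoMatrix d ξ).PosSemidef := by
  refine PosSemidef.of_dotProduct_mulVec_nonneg ?_ fun x => ?_
  · ext a b
    simp [infoMatrix, mul_comm]
  · have h : star x ⬝ᵥ infoMatrix d ξ *ᵥ x = ∫ z, (∑ a, x a * regressionVec d z a) ^ 2 ∂ξ := by
      have e : ∀ z, (∑ a, x a * regressionVec d z a) ^ 2 =
          ∑ a, ∑ b, x a * x b * (regressionVec d z a * regressionVec d z b) := fun z => by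
        rw [sq, Finset.sum_mul_sum]
        exact Finset.sum_congr rfl fun a _ => Finset.sum_congr rfl fun b _ => by ring
      simp_rw [e]
      rw [integral_finsetSum _ fun a _ => integrable_finsetSum _ fun b _ =>
        (integrable_regressionVec_mul a b).const_mul _]
      simp only [dotProduct, mulVec, Finset.mul_sum]
      refine Finset.sum_congr rfl fun a _ => ?_
      rw [integral_finsetSum _ fun b _ => (integrable_regressionVec_mul a b).const_mul _]
      refine Finset.sum_congr rfl fun b _ => ?_
      rw [integral_const_mul]
      simp only [infoMatrix, of_apply, Pi.star_apply, star_trivial]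
      ring
    rw [h]
    exact integral_nonneg fun z => sq_nonneg _

/-- The index of the coefficient selected by a column of the selection matrix. -/
def selectedIndex {q : ℕ} (k : Fin (q + 1) → Fin (d + 1)) (b : Σ i : Fin (q + 1), Order (k i)) :
    CoeffIndex d := ⟨k b.1, b.2⟩

theorem selectedIndex_injective {q : ℕ} {k : Fin (q + 1) → Fin (d + 1)}
    (hk : Function.Injective k) : Function.Injective (selectedIndex k) := by
  rintro ⟨i, m⟩ ⟨j, l⟩ h
  simp only [selectedIndex, Sigma.mk.injEq] at h
  obtain rfl := hk h.1
  obtain rfl := eq_of_heq h.2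
  rfl

theorem selectionMatrix_eq {q : ℕ} (k : Fin (q + 1) → Fin (d + 1)) :
    selectionMatrix k = (1 : Matrix _ _ ℝ).submatrix id (selectedIndex k) := by
  ext ⟨n, m⟩ ⟨i, l⟩
  simp only [selectionMatrix, of_apply, submatrix_apply, id, selectedIndex, Matrix.one_apply]
  congr 1
  rw [eq_iff_iff]
  constructor
  · rintro ⟨h1, h2⟩
    subst h1
    obtain rfl := Subtype.ext h2
    rfl
  · intro h
    cases h
    exact ⟨rfl, rfl⟩

theorem selectionMatrix_transpose_mul_mul {q : ℕ} (k : Fin (q + 1) → Fin (d + 1))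
    (A : Matrix (CoeffIndex d) (CoeffIndex d) ℝ) :
    (selectionMatrix k)ᵀ * A * selectionMatrix k =
      A.submatrix (selectedIndex k) (selectedIndex k) := by
  rw [selectionMatrix_eq, transpose_submatrix, transpose_one]
  ext a b
  simp [mul_apply, one_apply]

theorem selectionMatrix_transpose_mul_self {q : ℕ} {k : Fin (q + 1) → Fin (d + 1)}
    (hk : Function.Injective k) : (selectionMatrix k)ᵀ * selectionMatrix k = 1 := by
  have h := selectionMatrix_transpose_mul_mul k 1
  rwa [Matrix.mul_one, submatrix_one _ (selectedIndex_injective hk)] at h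

/-- By Unsöld's theorem the information on the selected coefficients has the same trace under
every design. -/
theorem trace_selectionMatrix_infoMatrix [IsProbabilityMeasure ξ] {q : ℕ}
    (k : Fin (q + 1) → Fin (d + 1)) :
    trace ((selectionMatrix k)ᵀ * infoMatrix d ξ * selectionMatrix k) =
      Fintype.card (Σ i : Fin (q + 1), Order (k i)) := by
  rw [selectionMatrix_transpose_mul_mul, trace, Fintype.sum_sigma, Fintype.card_sigma,
    Nat.cast_sum]
  refine Finset.sum_congr rfl fun i _ => ?_
  simp only [diag_apply, submatrix_apply, infoMatrix, of_apply]
  rw [← integral_finsetSum _ fun m _ => integrable_regressionVec_mul _ _]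
  have e : ∀ z : ℝ × ℝ, ∑ m : Order (k i), regressionVec d z (selectedIndex k ⟨i, m⟩) *
      regressionVec d z (selectedIndex k ⟨i, m⟩) = 2 * (((k i : Fin (d + 1)) : ℕ) : ℝ) + 1 :=
    fun z => by
      rw [← sum_sphHarmonic_sq (k i) z.1 z.2]
      exact Finset.sum_congr rfl fun m _ => (sq _).symm
  simp_rw [e]
  have hc : Fintype.card (Order (k i)) = 2 * ((k i : Fin (d + 1)) : ℕ) + 1 := by
    rw [Fintype.card_coe, Int.card_Icc]
    omega
  rw [hc]
  simp

theorem genInverse_one {n : Type*} [Fintype n] [DecidableEq n] :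
    genInverse (1 : Matrix n n ℝ) = 1 := by
  have h : 1 * genInverse (1 : Matrix n n ℝ) * 1 = 1 := isGenInverse_genInverse _
  simpa using h

theorem isPhiOptimal_uniformDesign {q : ℕ} {k : Fin (q + 1) → Fin (d + 1)}
    (hk : Function.Injective k) {p : WithBot ℝ} (hp : p < ((1 : ℝ) : WithBot ℝ)) :
    IsPhiOptimal p (selectionMatrix k) uniformDesign where
  isDesign := isDesign_uniformDesign
  estimable := by
    rw [infoMatrix_uniformDesign, Estimable, mulVecLin_one, LinearMap.range_id]
    exact le_top
  le ξ hξ hK := by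
    have := hξ.isProbabilityMeasure
    have : Nonempty (Σ i : Fin (q + 1), Order (k i)) :=
      ⟨⟨0, 0, by simp⟩⟩
    obtain ⟨hpd, htr⟩ := posDef_and_trace_inv_le posSemidef_infoMatrix hK
      (selectionMatrix_transpose_mul_self hk)
    rw [trace_selectionMatrix_infoMatrix] at htr
    rw [Phi, Phi, infoMatrix_uniformDesign, genInverse_one, Matrix.mul_one,
      selectionMatrix_transpose_mul_self hk]
    exact kiefer_le_kiefer_one hp hpd htr

end Design

end SphericalDesign

end

theorem theorem2p1 (d q : ℕ) (k : Fin (q + 1) → Fin (d + 1)) (hk : StrictMono k)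
    (p : WithBot ℝ) (hp : p < ((1 : ℝ) : WithBot ℝ)) :
    SphericalDesign.IsPhiOptimal p (SphericalDesign.selectionMatrix k)
        SphericalDesign.uniformDesign ∧
      SphericalDesign.infoMatrix d SphericalDesign.uniformDesign = 1 :=
  ⟨SphericalDesign.isPhiOptimal_uniformDesign hk.injective hp,
    SphericalDesign.infoMatrix_uniformDesign d⟩
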